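/- Let $\mathbb{D}=\{z\in\mathbb{C}:|z|<1\}$. For functions $g,h$ on $\mathbb{D}$ write $g\prec h$ ($g$ is subordinate to $h$) if there is an analytic function $w$ on $\mathbb{D}$ with $w(0)=0$ and $|w(z)|\le|z|$ such that $g(z)=h(w(z))$ for all $z\in\mathbb{D}$. Let $\gamma_1,\gamma_2,\gamma_3>0$ and let $m,k$ be real constants with $k\ge m\ge 2$. Suppose that either $$\gamma_1-\gamma_2-m^2\gamma_3-3m(k-1)\gamma_3-e(e+1)\ge e^2$$ or $$1-e-e\bigl(\gamma_1+\gamma_2+m^2\gamma_3+3m(k-1)\gamma_3\bigr)\ge e.$$ If $p$ is analytic in $\mathbb{D}$ with $p(0)=1$ and $$p(z)+\gamma_1zp'(z)+\gamma_2z^2p''(z)+\gamma_3z^3p'''(z)\prec 1+ze^z,$$ then $p(z)\prec e^z$. -/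

import Mathlib

/-- `w` is a Schwarz function: analytic on the open unit disk, with `w 0 = 0` and
`|w z| ≤ |z|` there. -/
def IsSchwarzFunction (w : ℂ → ℂ) : Prop :=
  AnalyticOnNhd ℂ w (Metric.ball 0 1) ∧ w 0 = 0 ∧ ∀ z ∈ Metric.ball (0 : ℂ) 1, ‖w z‖ ≤ ‖z‖

/-- Subordination `g ≺ h` on the open unit disk: `g = h ∘ w` there for some Schwarz
function `w`. -/
def Subordinate (g h : ℂ → ℂ) : Prop :=
  ∃ w : ℂ → ℂ, IsSchwarzFunction w ∧ ∀ z ∈ Metric.ball (0 : ℂ) 1, g z = h (w z)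

/-! On Taylor coefficients at 0 the differential operator is the multiplier `r n`, with `r n ≥ γ₁ n
≥ 17 n`. The subordinating function `1 + w e^w` is bounded by `1 + e < 4` on the disk, so Bessel's
inequality bounds the square sum of `r n * b n * z ^ n` by `4 ^ 2`. Dividing by `r n` and using `∑ 1
/ n ^ 2 ≤ 2` gives `‖p - 1‖ ≤ 1 / 2`. Then `log p` is analytic and maps the disk into itself, so by
the Schwarz lemma it is the required Schwarz function. -/

open Finset Complex in
/-- Bessel's inequality for an absolutely convergent power series bounded on the unit circle. -/
theorem sum_norm_sq_le_of_norm_tsum_le {b : ℕ → ℂ} {M : ℝ} (hM : 0 ≤ M)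
    (hb : Summable fun n => ‖b n‖) (hbound : ∀ u : ℂ, ‖u‖ = 1 → ‖∑' n, b n * u ^ n‖ ≤ M)
    (s : Finset ℕ) : ∑ n ∈ s, ‖b n‖ ^ 2 ≤ M ^ 2 := by
  let e : ℕ → C(UnitAddCircle, ℂ) := fun n => fourier (n : ℤ)
  have he : Summable fun n => b n • e n :=
    Summable.of_norm (by simpa [e, norm_smul, fourier_norm] using hb)
  let G : C(UnitAddCircle, ℂ) := ∑' n, b n • e n
  let L := ContinuousMap.toLp (E := ℂ) 2 (AddCircle.haarAddCircle (T := (1 : ℝ))) ℂ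
  have hG : ‖G‖ ≤ M := by
    rw [ContinuousMap.norm_le _ hM]
    intro x
    have hx : G x = ∑' n, b n * (AddCircle.toCircle x : ℂ) ^ n := by
      rw [← (ContinuousMap.hasSum_apply he.hasSum x).tsum_eq]
      congr with n
      simp [e, fourier_apply, AddCircle.toCircle_nsmul]
    rw [hx]
    exact hbound _ (Circle.norm_coe _)
  have hLG : ‖L G‖ ≤ M := by
    refine (L.le_opNorm G).trans ?_
    have := ContinuousMap.toLp_norm_le (μ := AddCircle.haarAddCircle (T := (1 : ℝ))) (p := 2) (E := ℂ) (𝕜 := ℂ)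
    rw [MeasureTheory.measureUnivNNReal, MeasureTheory.measure_univ, ENNReal.toNNReal_one,
      NNReal.coe_one, Real.one_rpow] at this
    exact (mul_le_of_le_one_left (norm_nonneg G) this).trans hG
  have horth : Orthonormal ℂ fun n : ℕ => L (e n) :=
    (orthonormal_fourier (T := (1 : ℝ))).comp _ Nat.cast_injective
  have hcoeff (n : ℕ) : inner ℂ (L (e n)) (L G) = b n := by
    have h := (he.hasSum.mapL L).mapL (innerSL ℂ (L (e n)))
    refine h.unique ?_
    convert! hasSum_ite_eq n (b n) using 2 with k
    rw [map_smul, map_smul, innerSL_apply_apply, orthonormal_iff_ite.mp horth]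
    obtain rfl | hkn := eq_or_ne k n
    · simp
    · simp [hkn, hkn.symm]
  calc ∑ n ∈ s, ‖b n‖ ^ 2 = ∑ n ∈ s, ‖inner ℂ (L (e n)) (L G)‖ ^ 2 := by simp_rw [hcoeff]
    _ ≤ ‖L G‖ ^ 2 := horth.sum_inner_products_le _
    _ ≤ M ^ 2 := by gcongr

/-- The Taylor expansion at the origin of `z ^ j * f⁽ʲ⁾(z)`. -/
theorem hasSum_pow_mul_iteratedDeriv {f : ℂ → ℂ} (hf : AnalyticOnNhd ℂ f (Metric.ball 0 1))
    {z : ℂ} (hz : z ∈ Metric.ball (0 : ℂ) 1) (j : ℕ) :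
    HasSum (fun n : ℕ => (n.descFactorial j : ℂ) * (iteratedDeriv n f 0 / n.factorial * z ^ n))
      (z ^ j * iteratedDeriv j f z) := by
  have hd : AnalyticOnNhd ℂ (iteratedDeriv j f) (Metric.ball 0 1) := by
    rw [iteratedDeriv_eq_iterate]
    exact hf.iterated_deriv j
  have h := (Complex.hasSum_taylorSeries_on_ball hd.differentiableOn hz).mul_left (z ^ j)
  -- Terms with `n < j` vanish, so the sum may be reindexed by `n + j`.
  refine ((add_left_injective j).hasSum_iff ?_).mp ?_
  · intro n hn
    have : n < j := by
      by_contra! hjn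
      exact hn ⟨n - j, Nat.sub_add_cancel hjn⟩
    simp [Nat.descFactorial_of_lt this]
  · convert! h using 1
    ext n
    have hfac : ((n + j).descFactorial j : ℂ) * (n.factorial : ℂ) = ((n + j).factorial : ℂ) := by
      have := Nat.factorial_mul_descFactorial (Nat.le_add_left j n)
      rw [Nat.add_sub_cancel] at this
      exact_mod_cast (mul_comm _ _).trans this
    have hn : (n.factorial : ℂ) ≠ 0 := by exact_mod_cast n.factorial_ne_zero
    have hnj : ((n + j).factorial : ℂ) ≠ 0 := by exact_mod_cast (n + j).factorial_ne_zero
    have hiter : iteratedDeriv n (iteratedDeriv j f) 0 = iteratedDeriv (n + j) f 0 := by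
      simp only [iteratedDeriv_eq_iterate, Function.iterate_add_apply]
    simp only [Function.comp_apply, smul_eq_mul, sub_zero, hiter]
    field_simp
    rw [← hfac]
    ring

theorem one_add_mul_exp_norm_le {w : ℂ} (hw : ‖w‖ ≤ 1) : ‖1 + w * Complex.exp w‖ ≤ 4 := by
  have h : ‖Complex.exp w‖ ≤ Real.exp 1 :=
    (Complex.norm_exp_le_exp_norm w).trans (Real.exp_le_exp.mpr hw)
  calc ‖1 + w * Complex.exp w‖ ≤ ‖(1 : ℂ)‖ + ‖w‖ * ‖Complex.exp w‖ := by
        rw [← norm_mul]; exact norm_add_le _ _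
    _ ≤ 1 + 1 * Real.exp 1 := by rw [norm_one]; gcongr
    _ ≤ 4 := by linarith [Real.exp_one_lt_d9]

/-- A function within `1 / 2` of `1` is subordinate to the exponential. -/
theorem subordinate_exp_of_norm_sub_one_le {p : ℂ → ℂ}
    (hp : AnalyticOnNhd ℂ p (Metric.ball 0 1)) (hp0 : p 0 = 1)
    (hbound : ∀ z ∈ Metric.ball (0 : ℂ) 1, ‖p z - 1‖ ≤ 1 / 2) : Subordinate p Complex.exp := by
  have hslit (z : ℂ) (hz : z ∈ Metric.ball (0 : ℂ) 1) : p z ∈ Complex.slitPlane := by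
    apply Complex.ball_one_subset_slitPlane
    rw [Metric.mem_ball, dist_eq_norm]
    linarith [hbound z hz]
  have hlog : AnalyticOnNhd ℂ (fun z => Complex.log (p z)) (Metric.ball 0 1) :=
    fun z hz => (hp z hz).clog (hslit z hz)
  have h0 : Complex.log (p 0) = 0 := by simp [hp0]
  refine ⟨fun z => Complex.log (p z), ⟨hlog, h0, fun z hz => ?_⟩, fun z hz => ?_⟩
  · refine Complex.norm_le_norm_of_mapsTo_ball (f := fun z => Complex.log (p z))
      hlog.differentiableOn ?_ h0 (mem_ball_zero_iff.mp hz)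
    intro y hy
    -- `‖log (1 + x)‖ ≤ (3 / 2) ‖x‖` for `‖x‖ ≤ 1 / 2`, hence at most `3 / 4` here.
    have := Complex.norm_log_one_add_half_le_self (hbound y hy)
    rw [add_sub_cancel] at this
    rw [mem_closedBall_zero_iff]
    linarith [hbound y hy]
  · exact (Complex.exp_log (Complex.slitPlane_ne_zero (hslit z hz))).symm

/-- If the coefficients `a n` dominate `17 n`, inverting the multiplier `a` sends a power series
bounded by `4` to one that stays within `1 / 2` of its constant term. -/
theorem norm_tsum_sub_le_of_multiplier {a b : ℕ → ℂ} (ha : ∀ n : ℕ, 17 * (n : ℝ) ≤ ‖a n‖)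
    {z q : ℂ} (hq : HasSum (fun n => b n * z ^ n) q)
    (hsq : ∀ s : Finset ℕ, ∑ n ∈ s, ‖a n * (b n * z ^ n)‖ ^ 2 ≤ 4 ^ 2) : ‖q - b 0‖ ≤ 1 / 2 := by
  have hq' : HasSum (fun n => b (n + 1) * z ^ (n + 1)) (q - b 0) := by
    simpa using (hasSum_nat_add_iff' 1).mpr hq
  refine le_of_tendsto hq'.tendsto_sum_nat.norm (Filter.Eventually.of_forall fun N => ?_)
  have hterm (n : ℕ) : ‖b (n + 1) * z ^ (n + 1)‖ ≤
      (1 / 34) * (‖a (n + 1) * (b (n + 1) * z ^ (n + 1))‖ ^ 2 / 4 + 4 * (((n + 1 : ℕ) : ℝ) ^ 2)⁻¹) := by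
    set x := ‖b (n + 1) * z ^ (n + 1)‖ with hx
    have hn : (0 : ℝ) < ((n + 1 : ℕ) : ℝ) := by positivity
    set m : ℝ := ((n + 1 : ℕ) : ℝ) with hm
    have h1 : 17 * m * x ≤ ‖a (n + 1) * (b (n + 1) * z ^ (n + 1))‖ := by
      rw [norm_mul]
      exact mul_le_mul_of_nonneg_right (ha _) (norm_nonneg _)
    set y := ‖a (n + 1) * (b (n + 1) * z ^ (n + 1))‖
    have h2 : x ≤ (1 / 17) * (y * m⁻¹) := by
      rw [← div_eq_mul_inv, ← mul_div_assoc, le_div_iff₀ hn]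
      linarith
    rw [← inv_pow]
    -- AM-GM, `2 y / m ≤ y² / 4 + 4 / m²`; summed, this gives at most `(4 + 8) / 34 < 1 / 2`.
    nlinarith [sq_nonneg (y / 2 - 2 * m⁻¹)]
  have hsum1 : ∑ n ∈ Finset.range N, ‖a (n + 1) * (b (n + 1) * z ^ (n + 1))‖ ^ 2 ≤ 4 ^ 2 := by
    simpa using hsq ((Finset.range N).map (addRightEmbedding 1))
  have hsum2 : ∑ n ∈ Finset.range N, (((n + 1 : ℕ) : ℝ) ^ 2)⁻¹ ≤ 2 := by
    have h := sum_Ioo_inv_sq_le (α := ℝ) 0 (N + 1)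
    have h' : Finset.Ioo 0 (N + 1) = (Finset.range N).map (addRightEmbedding 1) := by
      ext i
      simp only [Finset.mem_Ioo, Finset.mem_map, Finset.mem_range, addRightEmbedding_apply]
      exact ⟨fun hi => ⟨i - 1, by omega, by omega⟩, by rintro ⟨j, hj, rfl⟩; omega⟩
    rw [h', Finset.sum_map] at h
    simpa using h
  calc ‖∑ n ∈ Finset.range N, b (n + 1) * z ^ (n + 1)‖
      ≤ ∑ n ∈ Finset.range N, (1 / 34) *
        (‖a (n + 1) * (b (n + 1) * z ^ (n + 1))‖ ^ 2 / 4 + 4 * (((n + 1 : ℕ) : ℝ) ^ 2)⁻¹) :=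
        norm_sum_le_of_le _ fun n _ => hterm n
    _ = (1 / 34) * ((∑ n ∈ Finset.range N, ‖a (n + 1) * (b (n + 1) * z ^ (n + 1))‖ ^ 2) / 4
        + 4 * ∑ n ∈ Finset.range N, (((n + 1 : ℕ) : ℝ) ^ 2)⁻¹) := by
        rw [← Finset.mul_sum, Finset.sum_add_distrib, Finset.sum_div, Finset.mul_sum _ _ (4 : ℝ)]
    _ ≤ 1 / 2 := by linarith

theorem theorem4p2 (γ₁ γ₂ γ₃ m k : ℝ) (hγ₁ : 0 < γ₁) (hγ₂ : 0 < γ₂) (hγ₃ : 0 < γ₃)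
    (hm : 2 ≤ m) (hk : m ≤ k)
    (hcond :
      γ₁ - γ₂ - m ^ 2 * γ₃ - 3 * m * (k - 1) * γ₃ - Real.exp 1 * (Real.exp 1 + 1)
          ≥ Real.exp 1 ^ 2 ∨
      1 - Real.exp 1 - Real.exp 1 * (γ₁ + γ₂ + m ^ 2 * γ₃ + 3 * m * (k - 1) * γ₃)
          ≥ Real.exp 1)
    (p : ℂ → ℂ) (hp : AnalyticOnNhd ℂ p (Metric.ball 0 1)) (hp0 : p 0 = 1)
    (hsub : Subordinate
      (fun z => p z + (γ₁ : ℂ) * z * deriv p z + (γ₂ : ℂ) * z ^ 2 * iteratedDeriv 2 p z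
        + (γ₃ : ℂ) * z ^ 3 * iteratedDeriv 3 p z)
      (fun z => 1 + z * Complex.exp z)) :
    Subordinate p Complex.exp := by
  have he := Real.exp_one_gt_d9
  have hmk : 0 ≤ 3 * m * (k - 1) * γ₃ :=
    mul_nonneg (mul_nonneg (by linarith) (by linarith)) hγ₃.le
  have hγ : 17 ≤ γ₁ := by
    -- The first alternative gives `γ₁ ≥ 2 e² + e > 17`; the second is contradictory, as `1 - e <
    -- 0`.
    rcases hcond with h | h
    · nlinarith [mul_nonneg (sq_nonneg m) hγ₃.le]
    · have : 0 ≤ Real.exp 1 * (γ₁ + γ₂ + m ^ 2 * γ₃ + 3 * m * (k - 1) * γ₃) := by positivity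
      linarith
  obtain ⟨w, ⟨-, -, hw⟩, hF⟩ := hsub
  let r : ℕ → ℝ := fun n =>
    1 + γ₁ * n + γ₂ * n.descFactorial 2 + γ₃ * n.descFactorial 3
  let b : ℕ → ℂ := fun n => iteratedDeriv n p 0 / n.factorial
  have hb0 : b 0 = 1 := by simp [b, hp0]
  have hr (n : ℕ) : 17 * (n : ℝ) ≤ ‖(r n : ℂ)‖ := by
    refine le_trans ?_ ((le_abs_self (r n)).trans_eq (Complex.norm_real _).symm)
    have h1 : 17 * (n : ℝ) ≤ γ₁ * n := by gcongr
    have h2 : 0 ≤ γ₂ * n.descFactorial 2 := by positivity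
    have h3 : 0 ≤ γ₃ * n.descFactorial 3 := by positivity
    simp only [r]
    linarith
  have hq (z : ℂ) (hz : z ∈ Metric.ball (0 : ℂ) 1) : HasSum (fun n => b n * z ^ n) (p z) := by
    simpa using hasSum_pow_mul_iteratedDeriv hp hz 0
  have hsum (z : ℂ) (hz : z ∈ Metric.ball (0 : ℂ) 1) :
      HasSum (fun n => (r n : ℂ) * (b n * z ^ n)) (1 + w z * Complex.exp (w z)) := by
    rw [show 1 + w z * Complex.exp (w z) = _ from (hF z hz).symm]
    convert! (((hq z hz).add ((hasSum_pow_mul_iteratedDeriv hp hz 1).mul_left (γ₁ : ℂ))).add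
      ((hasSum_pow_mul_iteratedDeriv hp hz 2).mul_left (γ₂ : ℂ))).add
      ((hasSum_pow_mul_iteratedDeriv hp hz 3).mul_left (γ₃ : ℂ)) using 1
    · ext n
      simp only [r, b, Nat.descFactorial_one]
      push_cast
      ring
    · simp only [iteratedDeriv_one]
      ring
  refine subordinate_exp_of_norm_sub_one_le hp hp0 fun z hz => ?_
  rw [← hb0]
  refine norm_tsum_sub_le_of_multiplier hr (hq z hz) ?_
  refine sum_norm_sq_le_of_norm_tsum_le (by norm_num) (hsum z hz).summable.norm fun u hu => ?_
  -- With `z` fixed, the series in `u` on the unit circle is the one on the circle of radius `‖z‖`.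
  have hzu : z * u ∈ Metric.ball (0 : ℂ) 1 := by simpa [hu] using hz
  have heq : ∑' n, (r n : ℂ) * (b n * z ^ n) * u ^ n = 1 + w (z * u) * Complex.exp (w (z * u)) := by
    rw [← (hsum _ hzu).tsum_eq]
    congr with n
    rw [mul_pow]
    ring
  rw [heq]
  exact one_add_mul_exp_norm_le ((hw _ hzu).trans (mem_ball_zero_iff.mp hzu).le)
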